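/- The Catalan groupoids. For $n\ge 1$ the objects of the groupoid $\mathbf A_n$ are the associations (complete bracketings) of $n$ letters. Its morphisms are generated, under composition and inverses, by the tensor products $\phi\otimes\gamma$ of morphisms of $\mathbf A_a$ and $\mathbf A_b$ with $a+b=n$, and by new isomorphisms $\alpha_{f,g,h}: f\otimes(g\otimes h)\to(f\otimes g)\otimes h$ for associations $f,g,h$ of $i,j,k$ letters with $i+j+k=n$. The only relations are functoriality of $\otimes$ and naturality of $\alpha$ in $f,g,h$; no pentagon is required to commute. The subgroupoid $\mathbf T_n\subseteq\mathbf A_n$, which has the same objects, is generated in the same way by tensor products of morphisms of $\mathbf T_a$ and $\mathbf T_b$ and by those $\alpha_{f,g,h}$ for which $g$ is a single letter. The group $\pi(\mathbf A_n)$ is obtained from $\mathbf A_n$ by collapsing $\mathbf T_n$ to a point, i.e. it is the pushout of $\mathbf 1\leftarrow\mathbf T_n\to\mathbf A_n$ in groupoids. Every morphism of $\mathbf A_n$ has a class in $\pi(\mathbf A_n)$; composition of paths becomes multiplication. For a word $X$ in the free monoid on $\lambda,\rho$, let $X\langle i,j,k\rangle$ be the following set of morphisms: $\langle i,j,k\rangle$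 consists of the $\alpha_{f,g,h}$ with $f,g,h$ of $i,j,k$ letters; if $p$ is in $X\langle i,j,k\rangle$ and $t$ is an association of $a$ letters, then $\mathrm{Id}_t\otimes p$ is in $\lambda^aX\langle i,j,k\rangle$ and $p\otimes \mathrm{Id}_t$ is in $\rho^aX\langle i,j,k\rangle$. Theorem. 1. In $\pi(\mathbf A_7)$ all morphisms of each of the sets $\langle 4,2,1\rangle$, $\rho^3\langle 1,2,1\rangle$, $\langle 1,2,4\rangle$, $\lambda^3\langle 1,2,1\rangle$ have the same class, so that these symbols denote elements of $\pi(\mathbf A_7)$, and $$\langle 4,2,1\rangle\cdot\rho^3\langle 1,2,1\rangle=\rho^3\langle 1,2,1\rangle\cdot\langle 4,2,1\rangle,\qquad \langle 1,2,4\rangle\cdot\lambda^3\langle 1,2,1\rangle=\lambda^3\langle 1,2,1\rangle\cdot\langle 1,2,4\rangle .$$ Each of these two pairs is a basis of a free abelian subgroup of rank $2$. 2. These relations come from tori in $\mathbf A_7$. There is a functor $\Phi:\mathbf A_4\times\mathbf A_4\to\mathbf A_7$, injective on objects, that sends $(s,t)$ to the association obtained by substituting $s$ for the first letter of $t$. In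 $\pi(\mathbf A_7)$ the class of $\Phi(p,q)$ is trivial if $p,q\in\mathbf T_4$, it is $\rho^3\langle1,2,1\rangle$ if $p\in\langle1,2,1\rangle$ and $q\in\mathbf T_4$, and it is $\langle4,2,1\rangle$ if $p\in\mathbf T_4$ and $q\in\langle1,2,1\rangle$. (The groupoid $\mathbf A_4$ is generated by a pentagon, and $\mathbf T_4$ by all edges of the pentagon but $\langle 1,2,1\rangle$, so $\mathbf A_4\times\mathbf A_4$ is a product of two circles, a torus.) Likewise, with the last letter of $t$ in place of the first, for $\lambda^3\langle1,2,1\rangle$ and $\langle1,2,4\rangle$. 3. $\pi(\mathbf A_7)$ is not a free group. 4. For every $n\ge 7$ there is an injective homomorphism $\pi(\mathbf A_7)\to\pi(\mathbf A_n)$ that, with $m=n-7$, sends the class of $p$ to the class of $\mathrm{Id}_t\otimes p$ for every association $t$ of $m$ letters (if $m\geq 1$); and $\pi(\mathbf A_n)$ is not a free group. -/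

import Mathlib

open CategoryTheory

namespace CatalanGroupoid

/-- An association of letters: an element of the free magma on one generator. An association of
`n` letters is one of length `n`. -/
abbrev Assoc : Type := FreeMagma Unit

/-- The association of a single letter. -/
def letter : Assoc := FreeMagma.of ()

/-- Formal reassociations. They are generated, under identities, composition and inverses, by the
tensor products of reassociations of smaller words (the morphisms of `A_a × A_b`, mapped to `A_n`
by `U_{a,b}`) and by the new isomorphisms `f ⊗ (g ⊗ h) → (f ⊗ g) ⊗ h`
(the isomorphisms `V_{i,j,k}(Id_f, Id_g, Id_h, ι)`). -/
inductive Expr : Assoc → Assoc → Type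
  | id (f : Assoc) : Expr f f
  | comp {f g h : Assoc} (p : Expr f g) (q : Expr g h) : Expr f h
  | inv {f g : Assoc} (p : Expr f g) : Expr g f
  | tensor {f f' g g' : Assoc} (p : Expr f f') (q : Expr g g') : Expr (f * g) (f' * g')
  | assoc (f g h : Assoc) : Expr (f * (g * h)) ((f * g) * h)

/-- The identifications between formal reassociations: the least congruence that makes the formal
reassociations a groupoid, the tensor product (each `U_{a,b}`) a functor, and the reassociation
isomorphisms natural (each `V_{i,j,k}` a functor on `A_i × A_j × A_k × I`). No pentagon relation
is imposed. -/
inductive Rel : ∀ {f g : Assoc}, Expr f g → Expr f g → Prop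
  | refl {f g : Assoc} (p : Expr f g) : Rel p p
  | symm {f g : Assoc} {p q : Expr f g} : Rel p q → Rel q p
  | trans {f g : Assoc} {p q r : Expr f g} : Rel p q → Rel q r → Rel p r
  | comp_congr {f g h : Assoc} {p p' : Expr f g} {q q' : Expr g h} :
      Rel p p' → Rel q q' → Rel (p.comp q) (p'.comp q')
  | inv_congr {f g : Assoc} {p p' : Expr f g} : Rel p p' → Rel p.inv p'.inv
  | tensor_congr {f f' g g' : Assoc} {p p' : Expr f f'} {q q' : Expr g g'} :
      Rel p p' → Rel q q' → Rel (p.tensor q) (p'.tensor q')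
  | id_comp {f g : Assoc} (p : Expr f g) : Rel ((Expr.id f).comp p) p
  | comp_id {f g : Assoc} (p : Expr f g) : Rel (p.comp (Expr.id g)) p
  | comp_assoc {f g h k : Assoc} (p : Expr f g) (q : Expr g h) (r : Expr h k) :
      Rel ((p.comp q).comp r) (p.comp (q.comp r))
  | inv_comp {f g : Assoc} (p : Expr f g) : Rel (p.inv.comp p) (Expr.id g)
  | comp_inv {f g : Assoc} (p : Expr f g) : Rel (p.comp p.inv) (Expr.id f)
  | tensor_id (f g : Assoc) : Rel ((Expr.id f).tensor (Expr.id g)) (Expr.id (f * g))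
  | tensor_comp {f f' f'' g g' g'' : Assoc} (p : Expr f f') (p' : Expr f' f'')
      (q : Expr g g') (q' : Expr g' g'') :
      Rel ((p.comp p').tensor (q.comp q')) ((p.tensor q).comp (p'.tensor q'))
  | natural {f f' g g' h h' : Assoc} (p : Expr f f') (q : Expr g g') (r : Expr h h') :
      Rel ((Expr.assoc f g h).comp ((p.tensor q).tensor r))
        ((p.tensor (q.tensor r)).comp (Expr.assoc f' g' h'))

/-- Formal reassociations from `f` to `g` up to the identifications `Rel`. -/
def exprSetoid (f g : Assoc) : Setoid (Expr f g) where
  r := Rel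
  iseqv := ⟨Rel.refl, Rel.symm, Rel.trans⟩

/-- Reassociations (morphisms of the Catalan groupoids) from `f` to `g`. -/
def Reassoc (f g : Assoc) : Type := Quotient (exprSetoid f g)

namespace Reassoc

/-- The identity reassociation. -/
def id (f : Assoc) : Reassoc f f := Quotient.mk (exprSetoid f f) (Expr.id f)

/-- Composition of reassociations (`p` first, then `q`). -/
def comp {f g h : Assoc} (p : Reassoc f g) (q : Reassoc g h) : Reassoc f h :=
  Quotient.map₂ (sa := exprSetoid f g) (sb := exprSetoid g h) (sc := exprSetoid f h)
    Expr.comp (fun _ _ hp _ _ hq => Rel.comp_congr hp hq) p q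

/-- The inverse reassociation. -/
def inv {f g : Assoc} (p : Reassoc f g) : Reassoc g f :=
  Quotient.map (sa := exprSetoid f g) (sb := exprSetoid g f)
    Expr.inv (fun _ _ hp => Rel.inv_congr hp) p

/-- The tensor product of reassociations. -/
def tensor {f f' g g' : Assoc} (p : Reassoc f f') (q : Reassoc g g') :
    Reassoc (f * g) (f' * g') :=
  Quotient.map₂ (sa := exprSetoid f f') (sb := exprSetoid g g')
    (sc := exprSetoid (f * g) (f' * g'))
    Expr.tensor (fun _ _ hp _ _ hq => Rel.tensor_congr hp hq) p q

/-- The isomorphism `f ⊗ (g ⊗ h) → (f ⊗ g) ⊗ h`. -/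
def assoc (f g h : Assoc) : Reassoc (f * (g * h)) ((f * g) * h) :=
  Quotient.mk (exprSetoid _ _) (Expr.assoc f g h)

end Reassoc

/-- The objects of the Catalan groupoid `A_n`: associations of `n` letters. -/
def A (n : ℕ) : Type := {f : Assoc // f.length = n}

/-- The Catalan groupoid `A_n`. -/
instance (n : ℕ) : Groupoid (A n) where
  Hom f g := Reassoc f.1 g.1
  id f := Reassoc.id f.1
  comp p q := Reassoc.comp p q
  inv p := Reassoc.inv p
  id_comp p := Quotient.inductionOn p fun p => Quotient.sound (Rel.id_comp p)
  comp_id p := Quotient.inductionOn p fun p => Quotient.sound (Rel.comp_id p)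
  assoc p q r := Quotient.inductionOn₃ p q r fun p q r => Quotient.sound (Rel.comp_assoc p q r)
  inv_comp p := Quotient.inductionOn p fun p => Quotient.sound (Rel.inv_comp p)
  comp_inv p := Quotient.inductionOn p fun p => Quotient.sound (Rel.comp_inv p)

/-- The morphism of `A_n` given by a reassociation between associations of `n` letters. -/
def A.homMk {n : ℕ} {f g : A n} (p : Reassoc f.1 g.1) : f ⟶ g := p

/-- The reassociation underlying a morphism of `A_n`. -/
def A.reassoc {n : ℕ} {f g : A n} (p : f ⟶ g) : Reassoc f.1 g.1 := p

/-- The tensor product `A_a × A_b → A_{a+b}` on objects. -/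
def A.tensor {a b : ℕ} (f : A a) (g : A b) : A (a + b) :=
  ⟨f.1 * g.1, congrArg₂ (· + ·) f.2 g.2⟩

/-- The tensor product `A_a × A_b → A_{a+b}` on morphisms. -/
def A.tensorHom {a b : ℕ} {f f' : A a} {g g' : A b} (p : f ⟶ f') (q : g ⟶ g') :
    A.tensor f g ⟶ A.tensor f' g' :=
  A.homMk (Reassoc.tensor (A.reassoc p) (A.reassoc q))

/-- The morphisms of the maximal indiscrete subgroupoids `T_n` of the `A_n`: they are generated
by tensor products of such morphisms and by the isomorphisms `f ⊗ (x ⊗ h) → (f ⊗ x) ⊗ h` in which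
the middle word `x` is a single letter. -/
inductive InT : ∀ {f g : Assoc}, Reassoc f g → Prop
  | id (f : Assoc) : InT (Reassoc.id f)
  | comp {f g h : Assoc} {p : Reassoc f g} {q : Reassoc g h} :
      InT p → InT q → InT (p.comp q)
  | inv {f g : Assoc} {p : Reassoc f g} : InT p → InT p.inv
  | tensor {f f' g g' : Assoc} {p : Reassoc f f'} {q : Reassoc g g'} :
      InT p → InT q → InT (p.tensor q)
  | assoc (f h : Assoc) : InT (Reassoc.assoc f letter h)

/-- All the morphisms of `A_n`. -/
def Mor (n : ℕ) : Type := Σ (f g : A n), (f ⟶ g)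

/-- The relations of `π(A_n)` on the set of all morphisms of `A_n`: composition becomes
multiplication, and the morphisms of `T_n` become trivial. -/
inductive PiRel (n : ℕ) : FreeGroup (Mor n) → Prop
  | comp {f g h : A n} (p : f ⟶ g) (q : g ⟶ h) :
      PiRel n (FreeGroup.of ⟨f, g, p⟩ * FreeGroup.of ⟨g, h, q⟩ *
        (FreeGroup.of ⟨f, h, p ≫ q⟩)⁻¹)
  | triv {f g : A n} (p : f ⟶ g) (hp : InT (A.reassoc p)) : PiRel n (FreeGroup.of ⟨f, g, p⟩)

/-- The fundamental group `π(A_n) = π(A_n, T_n)`: the one-object groupoid obtained from `A_n` by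
collapsing `T_n` to a point. As `T_n` contains all the objects of `A_n`, the pushout of
`1 ← T_n → A_n` has one object, and it is the group generated by the morphisms of `A_n` with
the relations `PiRel n`. -/
def Pi (n : ℕ) : Type := PresentedGroup {r : FreeGroup (Mor n) | PiRel n r}

instance (n : ℕ) : Group (Pi n) :=
  inferInstanceAs (Group (PresentedGroup {r : FreeGroup (Mor n) | PiRel n r}))

/-- The element of `π(A_n)` given by a morphism of `A_n`. -/
def cls {n : ℕ} {f g : A n} (p : f ⟶ g) : Pi n :=
  PresentedGroup.of (rels := {r : FreeGroup (Mor n) | PiRel n r}) ⟨f, g, p⟩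

/-- The two generators of the monoid of prefixes. -/
inductive Side
  | lam
  | rho

/-- The letter `λ` in the free monoid on `λ` and `ρ`. -/
def lam : FreeMonoid Side := FreeMonoid.of Side.lam

/-- The letter `ρ` in the free monoid on `λ` and `ρ`. -/
def rho : FreeMonoid Side := FreeMonoid.of Side.rho

/-- `IsEdge i j k X p` says that the generating isomorphism `p` belongs to the class of edges
`X<i,j,k>`. The edges in `<i,j,k>` are the isomorphisms `f ⊗ (g ⊗ h) → (f ⊗ g) ⊗ h` with `f`,
`g`, `h` of lengths `i`, `j`, `k`; tensoring an edge with an association of `a` letters on its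
left adds `λ^a` to its prefix, and tensoring it with `a` letters on its right adds `ρ^a`. -/
inductive IsEdge (i j k : ℕ) : FreeMonoid Side → ∀ {f g : Assoc}, Reassoc f g → Prop
  | base (f g h : Assoc) (hf : f.length = i) (hg : g.length = j) (hh : h.length = k) :
      IsEdge i j k 1 (Reassoc.assoc f g h)
  | left (t : Assoc) {X : FreeMonoid Side} {f g : Assoc} {p : Reassoc f g} :
      IsEdge i j k X p → IsEdge i j k (lam ^ t.length * X) ((Reassoc.id t).tensor p)
  | right (t : Assoc) {X : FreeMonoid Side} {f g : Assoc} {p : Reassoc f g} :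
      IsEdge i j k X p → IsEdge i j k (rho ^ t.length * X) (p.tensor (Reassoc.id t))

/-- The set of the elements of `π(A_n)` that are given by the edges of `A_n` in `X<i,j,k>`. -/
def genClass (n : ℕ) (X : FreeMonoid Side) (i j k : ℕ) : Set (Pi n) :=
  {a | ∃ (f g : A n) (p : f ⟶ g), IsEdge i j k X (A.reassoc p) ∧ cls p = a}

/-- Substitute the association `s` for the first letter of an association. -/
def graftFirst (s : Assoc) : Assoc → Assoc
  | FreeMagma.of _ => s
  | FreeMagma.mul t u => graftFirst s t * u

/-- Substitute the association `s` for the last letter of an association. -/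
def graftLast (s : Assoc) : Assoc → Assoc
  | FreeMagma.of _ => s
  | FreeMagma.mul t u => t * graftLast s u

/-- The elements `a`, `b` of `π(A_7)` are the two circles of the torus that arises by substituting
associations of four letters for one letter (first or last, according to `graft`) of associations
of four letters. The groupoid `A_4` is a pentagon, with one edge `<1,2,1>` outside `T_4`, so
`A_4 × A_4` is a product of two pentagons. It is mapped to `A_7` by a functor `Φ` that is
injective on objects, and in `π(A_7)` the edge `<1,2,1>` of the substituted pentagon becomes `a`,
the edge `<1,2,1>` of the other pentagon becomes `b`, and the edges of `T_4` become trivial. -/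
def IsTorus (graft : Assoc → Assoc → Assoc) (a b : Pi 7) : Prop :=
  ∃ Φ : A 4 × A 4 ⥤ A 7,
    Function.Injective Φ.obj ∧
    (∀ s t : A 4, (Φ.obj (s, t)).1 = graft s.1 t.1) ∧
    ∀ (x y : A 4 × A 4) (p : x ⟶ y),
      (InT (A.reassoc p.1) → InT (A.reassoc p.2) → cls (Φ.map p) = 1) ∧
      (IsEdge 1 2 1 1 (A.reassoc p.1) → InT (A.reassoc p.2) → cls (Φ.map p) = a) ∧
      (InT (A.reassoc p.1) → IsEdge 1 2 1 1 (A.reassoc p.2) → cls (Φ.map p) = b)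

end CatalanGroupoid

open CatalanGroupoid

/-! The commuting relations are naturality squares. For `p` in `<1,2,1>`, naturality of `α` in its
first argument `f`, of four letters, has two opposite sides in `<4,2,1>` and two in `ρ^3<1,2,1>`;
naturality in the third argument gives the mirror image. In `π` opposite sides become equal, because
all edges of one class `X<i,j,k>` agree up to morphisms of `T`. This rests on the connectedness of
`T_n` (`tconn_of_length_eq`): only the lengths of the words involved matter, and an identity factor
can be taken apart letter by letter (`IsEdge.tequiv_wrap`).

Independence is seen in the integers. No pentagon is imposed, so every function `F i j k` vanishing
for `j = 1` is a weight on edges that defines a homomorphism from `π(A_n)` to `ℤ`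
(`exists_weightHom`); the indicators of two different triples are dual to the two edge classes. A
free group contains no free abelian subgroup of rank two, by Nielsen–Schreier
(`not_isFreeGroup_of_commute`).

The torus functor is grafting in both variables, and its functoriality is the interchange law
`graftFirst_natural` or `graftLast_natural`. Injectivity of tensoring with `Id_t` on the left
follows from a retraction: deleting the first letter respects all relations and preserves `T`, and
repeated deletion removes `t`. -/

namespace CatalanGroupoid

/-! ### Groupoid and tensor laws for reassociations -/

namespace Reassoc

theorem ind {f g : Assoc} {C : Reassoc f g → Prop}
    (h : ∀ p : Expr f g, C (Quotient.mk (exprSetoid f g) p)) (p : Reassoc f g) : C p :=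
  Quotient.ind h p

theorem id_comp {f g : Assoc} (p : Reassoc f g) : (id f).comp p = p :=
  Quotient.inductionOn p fun p => Quotient.sound (Rel.id_comp p)

theorem comp_id {f g : Assoc} (p : Reassoc f g) : p.comp (id g) = p :=
  Quotient.inductionOn p fun p => Quotient.sound (Rel.comp_id p)

theorem comp_assoc {f g h k : Assoc} (p : Reassoc f g) (q : Reassoc g h) (r : Reassoc h k) :
    (p.comp q).comp r = p.comp (q.comp r) :=
  Quotient.inductionOn₃ p q r fun p q r => Quotient.sound (Rel.comp_assoc p q r)

theorem inv_comp {f g : Assoc} (p : Reassoc f g) : p.inv.comp p = id g :=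
  Quotient.inductionOn p fun p => Quotient.sound (Rel.inv_comp p)

theorem comp_inv {f g : Assoc} (p : Reassoc f g) : p.comp p.inv = id f :=
  Quotient.inductionOn p fun p => Quotient.sound (Rel.comp_inv p)

theorem tensor_id (f g : Assoc) : (id f).tensor (id g) = id (f * g) :=
  Quotient.sound (Rel.tensor_id f g)

theorem tensor_comp {f f' f'' g g' g'' : Assoc} (p : Reassoc f f') (p' : Reassoc f' f'')
    (q : Reassoc g g') (q' : Reassoc g' g'') :
    (p.comp p').tensor (q.comp q') = (p.tensor q).comp (p'.tensor q') := by
  induction p using ind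
  induction p' using ind
  induction q using ind
  induction q' using ind
  exact Quotient.sound (Rel.tensor_comp _ _ _ _)

theorem natural {f f' g g' h h' : Assoc} (p : Reassoc f f') (q : Reassoc g g')
    (r : Reassoc h h') :
    (assoc f g h).comp ((p.tensor q).tensor r)
      = (p.tensor (q.tensor r)).comp (assoc f' g' h') :=
  Quotient.inductionOn₃ p q r fun p q r => Quotient.sound (Rel.natural p q r)

/-- This and the next lemma reflect a commuting square in its two directions. They serve the
symmetry of `TEquiv` and the inverse case of the interchange laws. -/
theorem comp_inv_eq {f g f' g' : Assoc} {p : Reassoc f g} {q : Reassoc f' g'}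
    {τ : Reassoc f f'} {σ : Reassoc g g'} (h : p.comp σ = τ.comp q) :
    q.comp σ.inv = τ.inv.comp p := by
  calc q.comp σ.inv = τ.inv.comp ((τ.comp q).comp σ.inv) := by
        rw [comp_assoc, ← comp_assoc, inv_comp, id_comp]
    _ = τ.inv.comp p := by rw [← h, comp_assoc, comp_inv, comp_id]

theorem inv_comp_eq {f g f' g' : Assoc} {p : Reassoc f g} {q : Reassoc f' g'}
    {τ : Reassoc f f'} {σ : Reassoc g g'} (h : p.comp σ = τ.comp q) :
    p.inv.comp τ = σ.comp q.inv := by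
  calc p.inv.comp τ = p.inv.comp ((τ.comp q).comp q.inv) := by
        rw [comp_assoc, comp_inv, comp_id]
    _ = σ.comp q.inv := by rw [← h, comp_assoc, ← comp_assoc, inv_comp, id_comp]

end Reassoc

theorem Expr.length_eq {f g : Assoc} (p : Expr f g) : f.length = g.length := by
  induction p with
  | id => rfl
  | comp _ _ hp hq => exact hp.trans hq
  | inv _ hp => exact hp.symm
  | tensor _ _ hp hq => exact congrArg₂ (· + ·) hp hq
  | assoc f g h => exact (add_assoc f.length g.length h.length).symm

theorem Reassoc.length_eq {f g : Assoc} (p : Reassoc f g) : f.length = g.length :=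
  Quotient.inductionOn p Expr.length_eq

/-! ### The group `Pi n` -/

theorem cls_comp {n : ℕ} {f g h : A n} (p : f ⟶ g) (q : g ⟶ h) :
    cls (p ≫ q) = cls p * cls q := by
  refine (mul_inv_eq_one.mp ?_).symm
  exact PresentedGroup.one_of_mem (PiRel.comp p q)

theorem cls_eq_one {n : ℕ} {f g : A n} (p : f ⟶ g) (hp : InT (A.reassoc p)) : cls p = 1 :=
  PresentedGroup.one_of_mem (PiRel.triv p hp)

/-- A multiplicative function on the morphisms of `A n` that is trivial on `InT` extends to a
homomorphism from `Pi n`. -/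
theorem exists_piHom {n : ℕ} {G : Type*} [Group G] (F : ∀ {f g : A n}, (f ⟶ g) → G)
    (hcomp : ∀ {f g h : A n} (p : f ⟶ g) (q : g ⟶ h), F (p ≫ q) = F p * F q)
    (htriv : ∀ {f g : A n} (p : f ⟶ g), InT (A.reassoc p) → F p = 1) :
    ∃ φ : Pi n →* G, ∀ {f g : A n} (p : f ⟶ g), φ (cls p) = F p := by
  refine ⟨PresentedGroup.toGroup (f := fun ⟨_, _, p⟩ => F p) ?_,
    fun p => PresentedGroup.toGroup.of _⟩
  rintro r (⟨p, q⟩ | ⟨p, hp⟩)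
  · rw [map_mul, map_mul, map_inv, mul_inv_eq_one]
    refine (congrArg₂ (· * ·) FreeGroup.lift_apply_of FreeGroup.lift_apply_of).trans ?_
    exact (hcomp p q).symm.trans FreeGroup.lift_apply_of.symm
  · exact FreeGroup.lift_apply_of.trans (htriv p hp)

theorem piHom_ext {n : ℕ} {G : Type*} [Group G] {φ ψ : Pi n →* G}
    (h : ∀ {f g : A n} (p : f ⟶ g), φ (cls p) = ψ (cls p)) : φ = ψ :=
  PresentedGroup.ext fun x => h x.2.2

/-! ### Connectedness of the groupoids `T_n` -/

/-- Two associations are connected by a morphism of some `T_n`. -/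
def TConn (f g : Assoc) : Prop := ∃ τ : Reassoc f g, InT τ

theorem TConn.refl (f : Assoc) : TConn f f := ⟨_, InT.id f⟩

theorem TConn.symm {f g : Assoc} : TConn f g → TConn g f := fun ⟨_, h⟩ => ⟨_, h.inv⟩

theorem TConn.trans {f g h : Assoc} : TConn f g → TConn g h → TConn f h :=
  fun ⟨_, h⟩ ⟨_, h'⟩ => ⟨_, h.comp h'⟩

theorem TConn.mul {f f' g g' : Assoc} : TConn f f' → TConn g g' → TConn (f * g) (f' * g') :=
  fun ⟨_, h⟩ ⟨_, h'⟩ => ⟨_, h.tensor h'⟩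

theorem eq_letter_of_length {f : Assoc} (h : f.length = 1) : f = letter := by
  cases f with
  | of => rfl
  | mul a b =>
    have := a.length_pos
    have := b.length_pos
    simp only [FreeMagma.length] at h
    omega

theorem length_mul (f g : Assoc) : (f * g).length = f.length + g.length := rfl

theorem length_letter : letter.length = 1 := rfl

/-- The association `((x x) x) ⋯ x` of `n + 1` letters. -/
def leftComb : ℕ → Assoc
  | 0 => letter
  | n + 1 => leftComb n * letter

theorem length_leftComb (n : ℕ) : (leftComb n).length = n + 1 := by
  induction n with
  | zero => rfl
  | succ n ih => rw [leftComb, length_mul, ih, length_letter]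

/-- The association `x (x ⋯ (x x))` of `n + 1` letters. -/
def rightComb : ℕ → Assoc
  | 0 => letter
  | n + 1 => letter * rightComb n

theorem length_rightComb (n : ℕ) : (rightComb n).length = n + 1 := by
  induction n with
  | zero => rfl
  | succ n ih => rw [rightComb, length_mul, ih, length_letter, add_comm]

/-- An `α` whose middle word is one letter moves that letter from the right factor to the left one.
The inner induction, on the length of the right factor, repeats this until a single letter remains
there; the outer one normalizes the smaller factors. -/
theorem tconn_leftComb (n : ℕ) : ∀ f : Assoc, f.length = n + 1 → TConn f (leftComb n) := by
  induction n using Nat.strong_induction_on with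
  | _ n ih =>
  have aux : ∀ (k : ℕ) (f h : Assoc), h.length = k + 1 → f.length + h.length = n + 1 →
      TConn (f * h) (leftComb n) := by
    intro k
    induction k with
    | zero =>
      intro f h hh hn
      obtain ⟨m, rfl⟩ : ∃ m, n = m + 1 :=
        ⟨n - 1, by have := f.length_pos; omega⟩
      rw [eq_letter_of_length hh]
      exact (ih m (by omega) f (by omega)).mul (TConn.refl _)
    | succ k ihk =>
      intro f h hh hn
      have hf := f.length_pos
      -- As `f` is nonempty, `h` has fewer letters than the whole word, so it can be rebracketed
      -- within `T` to expose a first letter.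
      have h1 := ih (k + 1) (by omega) h hh
      have h2 := ih (k + 1) (by omega) (letter * leftComb k)
        (by rw [length_mul, length_letter, length_leftComb]; omega)
      refine ((TConn.refl f).mul (h1.trans h2.symm)).trans
        (TConn.trans ⟨_, InT.assoc f (leftComb k)⟩
          (ihk (f * letter) (leftComb k) (length_leftComb k) ?_))
      rw [length_mul, length_letter, length_leftComb]
      omega
  intro f hf
  cases f with
  | of =>
    obtain rfl : n = 0 := by simpa [FreeMagma.length] using hf.symm
    exact TConn.refl _
  | mul a b =>
    have := b.length_pos
    exact aux (b.length - 1) a b (by omega) hf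

theorem tconn_of_length_eq {f g : Assoc} (h : f.length = g.length) : TConn f g := by
  have hf := f.length_pos
  exact (tconn_leftComb (f.length - 1) f (by omega)).trans
    (tconn_leftComb (f.length - 1) g (by omega)).symm

/-! ### Reassociations that agree up to morphisms of `T_n` -/

/-- The reassociations `p` and `p'` agree up to morphisms of `T_n` between their ends. -/
def TEquiv {f g f' g' : Assoc} (p : Reassoc f g) (p' : Reassoc f' g') : Prop :=
  ∃ (τ : Reassoc f f') (σ : Reassoc g g'), InT τ ∧ InT σ ∧ p.comp σ = τ.comp p'

namespace TEquiv

variable {f g f' g' f'' g'' : Assoc} {p : Reassoc f g} {p' : Reassoc f' g'}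
  {p'' : Reassoc f'' g''}

theorem refl (p : Reassoc f g) : TEquiv p p :=
  ⟨_, _, InT.id f, InT.id g, by rw [Reassoc.comp_id, Reassoc.id_comp]⟩

theorem symm : TEquiv p p' → TEquiv p' p :=
  fun ⟨_, _, hτ, hσ, h⟩ => ⟨_, _, hτ.inv, hσ.inv, Reassoc.comp_inv_eq h⟩

theorem trans : TEquiv p p' → TEquiv p' p'' → TEquiv p p'' := by
  rintro ⟨τ, σ, hτ, hσ, h⟩ ⟨τ', σ', hτ', hσ', h'⟩
  refine ⟨_, _, hτ.comp hτ', hσ.comp hσ', ?_⟩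
  rw [← Reassoc.comp_assoc, h, Reassoc.comp_assoc, h', Reassoc.comp_assoc]

theorem tensor {a b a' b' : Assoc} {q : Reassoc a b} {q' : Reassoc a' b'} :
    TEquiv p p' → TEquiv q q' → TEquiv (p.tensor q) (p'.tensor q') := by
  rintro ⟨τ, σ, hτ, hσ, h⟩ ⟨τ', σ', hτ', hσ', h'⟩
  refine ⟨_, _, hτ.tensor hτ', hσ.tensor hσ', ?_⟩
  rw [← Reassoc.tensor_comp, h, h', Reassoc.tensor_comp]

theorem id_of_length_eq {t u : Assoc} (h : t.length = u.length) :
    TEquiv (Reassoc.id t) (Reassoc.id u) := by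
  obtain ⟨τ, hτ⟩ := tconn_of_length_eq h
  exact ⟨τ, τ, hτ, hτ, by rw [Reassoc.comp_id, Reassoc.id_comp]⟩

/-- Naturality of `α` along morphisms of `T` that connect the three pairs of words. -/
theorem assoc_of_length_eq {a b c a' b' c' : Assoc} (ha : a.length = a'.length)
    (hb : b.length = b'.length) (hc : c.length = c'.length) :
    TEquiv (Reassoc.assoc a b c) (Reassoc.assoc a' b' c') := by
  obtain ⟨τ, hτ⟩ := tconn_of_length_eq ha
  obtain ⟨σ, hσ⟩ := tconn_of_length_eq hb
  obtain ⟨υ, hυ⟩ := tconn_of_length_eq hc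
  exact ⟨_, _, hτ.tensor (hσ.tensor hυ), (hτ.tensor hσ).tensor hυ, Reassoc.natural _ _ _⟩

/-- In the naturality square of `α` at `Id_t`, `Id_letter` and `p`, the two sides that are instances
of `α` have a single letter in the middle and so lie in `T`. -/
theorem id_mul_letter_tensor (t : Assoc) (p : Reassoc f g) :
    TEquiv ((Reassoc.id (t * letter)).tensor p)
      ((Reassoc.id t).tensor ((Reassoc.id letter).tensor p)) := by
  refine symm ⟨_, _, InT.assoc _ _, InT.assoc _ _, ?_⟩
  rw [← Reassoc.tensor_id, Reassoc.natural]

theorem tensor_id_letter_mul (t : Assoc) (p : Reassoc f g) :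
    TEquiv (p.tensor (Reassoc.id (letter * t)))
      ((p.tensor (Reassoc.id letter)).tensor (Reassoc.id t)) := by
  refine ⟨_, _, InT.assoc _ _, InT.assoc _ _, ?_⟩
  rw [← Reassoc.tensor_id, Reassoc.natural]

theorem cls_eq {n : ℕ} {f g f' g' : A n} {p : f ⟶ g} {p' : f' ⟶ g'}
    (h : TEquiv (A.reassoc p) (A.reassoc p')) : cls p = cls p' := by
  obtain ⟨τ, σ, hτ, hσ, h⟩ := h
  have h' : p ≫ A.homMk σ = A.homMk τ ≫ p' := h
  have := congrArg cls h'
  rwa [cls_comp, cls_comp, cls_eq_one (A.homMk τ) hτ, cls_eq_one (A.homMk σ) hσ, mul_one,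
    one_mul] at this

end TEquiv

/-! ### All edges in a class `X<i,j,k>` agree up to morphisms of `T_n` -/

/-- A reassociation with its ends. -/
abbrev Arrow : Type := Σ f g : Assoc, Reassoc f g

/-- Tensor a reassociation with a letter, on the given side. -/
def Arrow.cons : Side → Arrow → Arrow
  | Side.lam, p => ⟨_, _, (Reassoc.id letter).tensor p.2.2⟩
  | Side.rho, p => ⟨_, _, p.2.2.tensor (Reassoc.id letter)⟩

/-- The reassociation obtained by tensoring with one letter after the other, as told by a word. -/
def Arrow.wrap (X : FreeMonoid Side) (p : Arrow) : Arrow := X.toList.foldr Arrow.cons p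

theorem Arrow.wrap_mul (X Y : FreeMonoid Side) (p : Arrow) :
    wrap (X * Y) p = wrap X (wrap Y p) := List.foldr_append

/-- Only the length of `t` matters, so `t` may be taken to be a left comb; its last letter, the one
next to `p`, can then be split off repeatedly. On the other side the right comb plays this role. -/
theorem tequiv_wrap_lam (t : Assoc) (p : Arrow) :
    TEquiv ((Reassoc.id t).tensor p.2.2) (Arrow.wrap (lam ^ t.length) p).2.2 := by
  obtain ⟨n, hn⟩ : ∃ n, t.length = n + 1 := ⟨t.length - 1, by have := t.length_pos; omega⟩
  refine ((TEquiv.id_of_length_eq (hn.trans (length_leftComb n).symm)).tensor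
    (TEquiv.refl _)).trans ?_
  rw [hn]
  clear hn
  induction n generalizing p with
  | zero => exact TEquiv.refl _
  | succ n ih =>
    rw [pow_succ, Arrow.wrap_mul]
    exact (TEquiv.id_mul_letter_tensor _ _).trans (ih (Arrow.cons Side.lam p))

theorem tequiv_wrap_rho (t : Assoc) (p : Arrow) :
    TEquiv (p.2.2.tensor (Reassoc.id t)) (Arrow.wrap (rho ^ t.length) p).2.2 := by
  obtain ⟨n, hn⟩ : ∃ n, t.length = n + 1 := ⟨t.length - 1, by have := t.length_pos; omega⟩
  refine ((TEquiv.refl _).tensor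
    (TEquiv.id_of_length_eq (hn.trans (length_rightComb n).symm))).trans ?_
  rw [hn]
  clear hn
  induction n generalizing p with
  | zero => exact TEquiv.refl _
  | succ n ih =>
    rw [pow_succ, Arrow.wrap_mul]
    exact (TEquiv.tensor_id_letter_mul _ _).trans (ih (Arrow.cons Side.rho p))

/-- A normal form for edges: blocks of identity factors are replaced by single letters in the order
of the word `X`, so the grouping of `X` into powers is forgotten. -/
theorem IsEdge.tequiv_wrap {X : FreeMonoid Side} {a b c f g : Assoc} {p : Reassoc f g}
    (hp : IsEdge a.length b.length c.length X p) :
    TEquiv p (Arrow.wrap X ⟨_, _, Reassoc.assoc a b c⟩).2.2 := by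
  induction hp with
  | base f g h hf hg hh => exact TEquiv.assoc_of_length_eq hf hg hh
  | left t hp ih =>
    rw [Arrow.wrap_mul]
    exact ((TEquiv.refl _).tensor ih).trans (tequiv_wrap_lam t _)
  | right t hp ih =>
    rw [Arrow.wrap_mul]
    exact (ih.tensor (TEquiv.refl _)).trans (tequiv_wrap_rho t _)

theorem IsEdge.exists_lengths {i j k : ℕ} {X : FreeMonoid Side} {f g : Assoc} {p : Reassoc f g}
    (hp : IsEdge i j k X p) : ∃ a b c : Assoc, a.length = i ∧ b.length = j ∧ c.length = k := by
  induction hp with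
  | base f g h hf hg hh => exact ⟨f, g, h, hf, hg, hh⟩
  | left t hp ih => exact ih
  | right t hp ih => exact ih

theorem IsEdge.tequiv {i j k : ℕ} {X : FreeMonoid Side} {f g f' g' : Assoc} {p : Reassoc f g}
    {p' : Reassoc f' g'} (hp : IsEdge i j k X p) (hp' : IsEdge i j k X p') : TEquiv p p' := by
  obtain ⟨a, b, c, rfl, rfl, rfl⟩ := hp.exists_lengths
  exact hp.tequiv_wrap.trans hp'.tequiv_wrap.symm

theorem genClass_eq_singleton {n i j k : ℕ} {X : FreeMonoid Side} {f g : A n} {p : f ⟶ g}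
    (hp : IsEdge i j k X (A.reassoc p)) : genClass n X i j k = {cls p} := by
  ext a
  constructor
  · rintro ⟨f', g', p', hp', rfl⟩
    exact TEquiv.cls_eq (hp'.tequiv hp)
  · rintro rfl
    exact ⟨f, g, p, hp, rfl⟩

/-! ### Deleting the first letter -/

/-- Delete the first letter of an association of at least two letters. -/
def dropFirst : Assoc → Assoc
  | FreeMagma.of a => FreeMagma.of a
  | FreeMagma.mul (FreeMagma.of _) g => g
  | FreeMagma.mul (FreeMagma.mul a b) g => dropFirst (FreeMagma.mul a b) * g

theorem length_dropFirst : ∀ (f : Assoc), f.length ≠ 1 → (dropFirst f).length + 1 = f.length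
  | FreeMagma.of _, h => absurd rfl h
  | FreeMagma.mul (FreeMagma.of _) g, _ => Nat.add_comm _ _
  | FreeMagma.mul (FreeMagma.mul a b) g, _ => by
    have h : (FreeMagma.mul a b).length ≠ 1 := by
      have := a.length_pos
      have := b.length_pos
      simp only [FreeMagma.length]
      omega
    have ih := length_dropFirst (FreeMagma.mul a b) h
    simp only [dropFirst, length_mul]
    simp only [FreeMagma.length] at ih ⊢
    omega

theorem length_mul_ne_length_of {a b : Assoc} {u : Unit} :
    (FreeMagma.mul a b).length ≠ (FreeMagma.of u).length := by
  have := a.length_pos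
  have := b.length_pos
  simp only [FreeMagma.length]
  omega

/-- The tensor product of `p`, with its first letter deleted, and `q`. -/
def dropFirstTensor : ∀ {f f' g g' : Assoc}, f.length = f'.length →
    Reassoc (dropFirst f) (dropFirst f') → Reassoc g g' →
      Reassoc (dropFirst (f * g)) (dropFirst (f' * g'))
  | FreeMagma.of _, FreeMagma.of _, _, _, _, _, q => q
  | FreeMagma.mul _ _, FreeMagma.mul _ _, _, _, _, p, q => p.tensor q
  | FreeMagma.of _, FreeMagma.mul _ _, _, _, h, _, _ => absurd h.symm length_mul_ne_length_of
  | FreeMagma.mul _ _, FreeMagma.of _, _, _, h, _, _ => absurd h length_mul_ne_length_of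

/-- The isomorphism `f ⊗ (g ⊗ h) → (f ⊗ g) ⊗ h` with its first letter deleted. -/
def dropFirstAssoc : ∀ f g h : Assoc,
    Reassoc (dropFirst (f * (g * h))) (dropFirst ((f * g) * h))
  | FreeMagma.of _, g, h => Reassoc.id (g * h)
  | FreeMagma.mul a b, g, h => Reassoc.assoc (dropFirst (FreeMagma.mul a b)) g h

/-- Delete the first letter of a formal reassociation. -/
def Expr.dropFirst : ∀ {f g : Assoc}, Expr f g →
    Reassoc (CatalanGroupoid.dropFirst f) (CatalanGroupoid.dropFirst g)
  | _, _, .id f => Reassoc.id _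
  | _, _, .comp p q => p.dropFirst.comp q.dropFirst
  | _, _, .inv p => p.dropFirst.inv
  | _, _, .tensor p q =>
    dropFirstTensor p.length_eq p.dropFirst (Quotient.mk (exprSetoid _ _) q)
  | _, _, .assoc f g h => dropFirstAssoc f g h

theorem dropFirstTensor_id (f g : Assoc) :
    dropFirstTensor rfl (Reassoc.id (dropFirst f)) (Reassoc.id g)
      = Reassoc.id (dropFirst (f * g)) := by
  cases f with
  | of => rfl
  | mul a b => exact Reassoc.tensor_id _ _

theorem dropFirstTensor_comp {f f' f'' g g' g'' : Assoc} (h : f.length = f'.length)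
    (h' : f'.length = f''.length)
    (p : Reassoc (dropFirst f) (dropFirst f')) (p' : Reassoc (dropFirst f') (dropFirst f''))
    (q : Reassoc g g') (q' : Reassoc g' g'') :
    dropFirstTensor (h.trans h') (p.comp p') (q.comp q')
      = (dropFirstTensor h p q).comp (dropFirstTensor h' p' q') := by
  cases f <;> cases f' <;> cases f'' <;>
    first
    | exact absurd h length_mul_ne_length_of
    | exact absurd h.symm length_mul_ne_length_of
    | exact absurd h' length_mul_ne_length_of
    | exact absurd h'.symm length_mul_ne_length_of
    | rfl
    | exact Reassoc.tensor_comp _ _ _ _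

/-- If `f` is one letter, both instances of `α` become identities and both tensor products become `q
⊗ r`. Otherwise the deletion takes place inside `f`, and naturality of `α` applies. -/
theorem dropFirst_natural {f f' g g' h h' : Assoc} (hl : f.length = f'.length)
    (hl' : (f * g).length = (f' * g').length)
    (p : Reassoc (dropFirst f) (dropFirst f')) (q : Reassoc g g') (r : Reassoc h h') :
    (dropFirstAssoc f g h).comp (dropFirstTensor hl' (dropFirstTensor hl p q) r)
      = (dropFirstTensor hl p (q.tensor r)).comp (dropFirstAssoc f' g' h') := by
  cases f <;> cases f' <;>
    first
    | exact absurd hl length_mul_ne_length_of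
    | exact absurd hl.symm length_mul_ne_length_of
    | exact (Reassoc.id_comp _).trans (Reassoc.comp_id _).symm
    | exact Reassoc.natural _ _ _

theorem Rel.dropFirst_eq {f g : Assoc} {p q : Expr f g} (h : Rel p q) :
    p.dropFirst = q.dropFirst := by
  induction h with
  | refl p => rfl
  | symm _ ih => exact ih.symm
  | trans _ _ ih ih' => exact ih.trans ih'
  | comp_congr _ _ ih ih' => simp only [Expr.dropFirst, ih, ih']
  | inv_congr _ ih => simp only [Expr.dropFirst, ih]
  | tensor_congr _ hq ih _ =>
    simp only [Expr.dropFirst, ih]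
    exact congrArg _ (Quotient.sound hq)
  | id_comp p => exact Reassoc.id_comp _
  | comp_id p => exact Reassoc.comp_id _
  | comp_assoc p q r => exact Reassoc.comp_assoc _ _ _
  | inv_comp p => exact Reassoc.inv_comp _
  | comp_inv p => exact Reassoc.comp_inv _
  | tensor_id f g => exact dropFirstTensor_id f g
  | tensor_comp p p' q q' =>
    exact dropFirstTensor_comp p.length_eq p'.length_eq p.dropFirst p'.dropFirst
      (Quotient.mk (exprSetoid _ _) q) (Quotient.mk (exprSetoid _ _) q')
  | natural p q r => exact dropFirst_natural p.length_eq (p.tensor q).length_eq _ _ _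

/-- Delete the first letter of a reassociation. -/
def Reassoc.dropFirst {f g : Assoc} (p : Reassoc f g) :
    Reassoc (CatalanGroupoid.dropFirst f) (CatalanGroupoid.dropFirst g) :=
  Quotient.lift (s := exprSetoid f g) Expr.dropFirst (fun _ _ h => Rel.dropFirst_eq h) p

namespace Reassoc

theorem dropFirst_comp {f g h : Assoc} (p : Reassoc f g) (q : Reassoc g h) :
    (p.comp q).dropFirst = p.dropFirst.comp q.dropFirst :=
  Quotient.inductionOn₂ p q fun _ _ => rfl

theorem dropFirst_inv {f g : Assoc} (p : Reassoc f g) : p.inv.dropFirst = p.dropFirst.inv :=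
  Quotient.inductionOn p fun _ => rfl

theorem dropFirst_tensor {f f' g g' : Assoc} (p : Reassoc f f') (q : Reassoc g g') :
    (p.tensor q).dropFirst = dropFirstTensor p.length_eq p.dropFirst q :=
  Quotient.inductionOn₂ p q fun _ _ => rfl

end Reassoc

/-- A generating `α` either collapses to an identity or keeps its middle letter, so it stays in `T`.
-/
theorem InT.dropFirst {f g : Assoc} {p : Reassoc f g} (hp : InT p) : InT p.dropFirst := by
  induction hp with
  | id f => exact InT.id _
  | comp _ _ ih ih' => rw [Reassoc.dropFirst_comp]; exact ih.comp ih'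
  | inv _ ih => rw [Reassoc.dropFirst_inv]; exact ih.inv
  | @tensor f f' g g' p q hp hq ih ih' =>
    rw [Reassoc.dropFirst_tensor]
    have h := p.length_eq
    cases f <;> cases f' <;>
      first
      | exact absurd h length_mul_ne_length_of
      | exact absurd h.symm length_mul_ne_length_of
      | exact hq
      | exact ih.tensor hq
  | assoc f h =>
    cases f with
    | of => exact InT.id _
    | mul a b => exact InT.assoc _ _

/-- Deleting the first letter, as a map from the objects of `A k` to those of `A l`. -/
def A.dropFirst {k l : ℕ} (hl : l ≠ 0) (hk : k = l + 1) (f : A k) : A l :=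
  ⟨CatalanGroupoid.dropFirst f.1, by
    have h := f.2
    have := length_dropFirst f.1 (by omega)
    omega⟩

/-- Deleting the first letter gives a homomorphism of fundamental groups. -/
theorem exists_piDropFirst {k l : ℕ} (hl : l ≠ 0) (hk : k = l + 1) :
    ∃ φ : Pi k →* Pi l, ∀ {f g : A k} (p : f ⟶ g),
      φ (cls p) = cls (f := A.dropFirst hl hk f) (g := A.dropFirst hl hk g)
        (A.homMk (A.reassoc p).dropFirst) :=
  exists_piHom _
    (fun p q => (congrArg cls (Reassoc.dropFirst_comp (A.reassoc p) (A.reassoc q))).trans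
      (cls_comp _ _))
    (fun _ hp => cls_eq_one _ hp.dropFirst)

theorem TEquiv.dropFirst {f g f' g' : Assoc} {p : Reassoc f g} {p' : Reassoc f' g'} :
    TEquiv p p' → TEquiv p.dropFirst p'.dropFirst := by
  rintro ⟨τ, σ, hτ, hσ, h⟩
  refine ⟨_, _, hτ.dropFirst, hσ.dropFirst, ?_⟩
  rw [← Reassoc.dropFirst_comp, h, Reassoc.dropFirst_comp]

/-! ### Tensoring with identities on the left -/

theorem A.tensorHom_id_comp {m n : ℕ} (t : A m) {f g h : A n} (p : f ⟶ g) (q : g ⟶ h) :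
    A.tensorHom (𝟙 t) (p ≫ q) = A.tensorHom (𝟙 t) p ≫ A.tensorHom (𝟙 t) q := by
  change (Reassoc.id t.1).tensor ((A.reassoc p).comp (A.reassoc q))
    = ((Reassoc.id t.1).tensor (A.reassoc p)).comp ((Reassoc.id t.1).tensor (A.reassoc q))
  rw [← Reassoc.tensor_comp, Reassoc.id_comp]

/-- The retraction `ψ` deletes the first letter `m + 1` times, which consumes `t`. Stating the
hypothesis on `q` up to `TEquiv` leaves its ends free, so the induction needs no equalities between
objects. -/
theorem exists_cls_eq_of_tequiv_tensor {n : ℕ} (hn : n ≠ 0) (m : ℕ) :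
    ∀ k : ℕ, k = m + 1 + n → ∃ ψ : Pi k →* Pi n,
      ∀ (t : Assoc) (f g : A n) (p : f ⟶ g) (f' g' : A k) (q : f' ⟶ g'), t.length = m + 1 →
        TEquiv (A.reassoc q) ((Reassoc.id t).tensor (A.reassoc p)) → ψ (cls q) = cls p := by
  induction m with
  | zero =>
    intro k hk
    obtain ⟨δ, hδ⟩ := exists_piDropFirst hn (by omega : k = n + 1)
    refine ⟨δ, fun t f g p f' g' q ht h => ?_⟩
    rw [hδ]
    obtain rfl := eq_letter_of_length ht
    have h' := h.dropFirst
    rw [Reassoc.dropFirst_tensor] at h'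
    exact TEquiv.cls_eq h'
  | succ m ih =>
    intro k hk
    obtain ⟨ψ, hψ⟩ := ih (m + 1 + n) rfl
    obtain ⟨δ, hδ⟩ := exists_piDropFirst (by omega) (by omega : k = m + 1 + n + 1)
    refine ⟨ψ.comp δ, fun t f g p f' g' q ht h => ?_⟩
    rw [MonoidHom.comp_apply, hδ]
    have hd := length_dropFirst t (by omega)
    refine hψ (dropFirst t) f g p _ _ _ (by omega) ?_
    have h' := h.dropFirst
    rw [Reassoc.dropFirst_tensor] at h'
    cases t with
    | of => exact absurd ht (by simp [FreeMagma.length])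
    | mul a b => exact h'

/-- Tensoring with the identity of an association on the left gives an injective homomorphism of
fundamental groups, which depends only on the number of letters of the association. -/
theorem exists_injective_piTensorLeft {n : ℕ} (hn : n ≠ 0) (m : ℕ) :
    ∃ φ : Pi n →* Pi (m + 1 + n), Function.Injective φ ∧
      ∀ (t : A (m + 1)) (f g : A n) (p : f ⟶ g), φ (cls p) = cls (A.tensorHom (𝟙 t) p) := by
  let t₀ : A (m + 1) := ⟨leftComb m, length_leftComb m⟩
  obtain ⟨φ, hφ⟩ := exists_piHom (n := n) (fun p => cls (A.tensorHom (𝟙 t₀) p))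
    (fun p q => by rw [A.tensorHom_id_comp, cls_comp])
    (fun _ hp => cls_eq_one _ ((InT.id _).tensor hp))
  obtain ⟨ψ, hψ⟩ := exists_cls_eq_of_tequiv_tensor hn m (m + 1 + n) rfl
  -- Deleting the letters of `t₀` undoes the tensoring; any other `t` of the same length gives the
  -- same classes.
  refine ⟨φ, Function.LeftInverse.injective (g := ψ) (DFunLike.congr_fun (f := ψ.comp φ)
    (g := MonoidHom.id _) (piHom_ext fun p => ?_)), fun t f g p => ?_⟩
  · rw [MonoidHom.comp_apply, hφ]
    exact hψ t₀.1 _ _ p _ _ _ t₀.2 (TEquiv.refl _)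
  · rw [hφ]
    exact TEquiv.cls_eq
      ((TEquiv.id_of_length_eq (t₀.2.trans t.2.symm)).tensor (TEquiv.refl _))

/-! ### Substitution for the first letter -/

theorem length_graftFirst (s t : Assoc) :
    (graftFirst s t).length + 1 = s.length + t.length := by
  induction t with
  | of => rfl
  | mul t u iht ihu =>
    simp only [graftFirst, length_mul, FreeMagma.mul_eq] at iht ⊢
    omega

/-- Equal lengths of `s` and `s'` force equal lengths of `t` and `t'`, so a letter is never matched
with a product and the two trees can be compared node by node. -/
theorem graftFirst_injective {s s' : Assoc} (hs : s.length = s'.length) {t t' : Assoc}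
    (h : graftFirst s t = graftFirst s' t') : s = s' ∧ t = t' := by
  induction t generalizing t' with
  | of =>
    cases t' with
    | of => exact ⟨h, rfl⟩
    | mul t' u' =>
      have h1 := length_graftFirst s' (FreeMagma.mul t' u')
      rw [← h] at h1
      have h2 := t'.length_pos
      have h3 := u'.length_pos
      simp only [graftFirst, FreeMagma.length] at h1
      omega
  | mul t u iht ihu =>
    cases t' with
    | of =>
      have h1 := length_graftFirst s (FreeMagma.mul t u)
      rw [h] at h1
      have h2 := t.length_pos
      have h3 := u.length_pos
      simp only [graftFirst, FreeMagma.length] at h1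
      omega
    | mul t' u' =>
      injection h with h1 h2
      obtain ⟨h3, h4⟩ := iht h1
      exact ⟨h3, congrArg₂ _ h4 h2⟩

/-- Substitute a reassociation for the first letter of an association. -/
def graftFirstLeft {s s' : Assoc} (p : Reassoc s s') : ∀ t : Assoc,
    Reassoc (graftFirst s t) (graftFirst s' t)
  | FreeMagma.of _ => p
  | FreeMagma.mul t u => (graftFirstLeft p t).tensor (Reassoc.id u)

/-- Substitute an association for the first letter of a formal reassociation. -/
def Expr.graftFirst (s : Assoc) : ∀ {t t' : Assoc}, Expr t t' →
    Expr (CatalanGroupoid.graftFirst s t) (CatalanGroupoid.graftFirst s t')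
  | _, _, .id t => .id _
  | _, _, .comp p q => (p.graftFirst s).comp (q.graftFirst s)
  | _, _, .inv p => (p.graftFirst s).inv
  | _, _, .tensor p q => (p.graftFirst s).tensor q
  | _, _, .assoc f g h => .assoc (CatalanGroupoid.graftFirst s f) g h

theorem Rel.graftFirst (s : Assoc) {t t' : Assoc} {p q : Expr t t'} (h : Rel p q) :
    Rel (p.graftFirst s) (q.graftFirst s) := by
  induction h with
  | refl p => exact .refl _
  | symm _ ih => exact .symm ih
  | trans _ _ ih ih' => exact .trans ih ih'
  | comp_congr _ _ ih ih' => exact .comp_congr ih ih'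
  | inv_congr _ ih => exact .inv_congr ih
  | tensor_congr _ hq ih _ => exact .tensor_congr ih hq
  | id_comp p => exact .id_comp _
  | comp_id p => exact .comp_id _
  | comp_assoc p q r => exact .comp_assoc _ _ _
  | inv_comp p => exact .inv_comp _
  | comp_inv p => exact .comp_inv _
  | tensor_id f g => exact .tensor_id _ _
  | tensor_comp p p' q q' => exact .tensor_comp _ _ _ _
  | natural p q r => exact .natural _ _ _

/-- Substitute an association for the first letter of a reassociation. -/
def graftFirstRight (s : Assoc) {t t' : Assoc} (q : Reassoc t t') :
    Reassoc (graftFirst s t) (graftFirst s t') :=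
  Quotient.map (sa := exprSetoid t t') (sb := exprSetoid _ _)
    (Expr.graftFirst s) (fun _ _ h => Rel.graftFirst s h) q

theorem graftFirstLeft_id (s t : Assoc) :
    graftFirstLeft (Reassoc.id s) t = Reassoc.id (graftFirst s t) := by
  induction t with
  | of => rfl
  | mul t u iht ihu =>
    exact (congrArg (fun p => Reassoc.tensor p (Reassoc.id u)) iht).trans (Reassoc.tensor_id _ _)

theorem graftFirstLeft_comp {s s' s'' : Assoc} (p : Reassoc s s') (p' : Reassoc s' s'')
    (t : Assoc) :
    graftFirstLeft (p.comp p') t = (graftFirstLeft p t).comp (graftFirstLeft p' t) := by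
  induction t with
  | of => rfl
  | mul t u iht ihu =>
    refine (congrArg₂ Reassoc.tensor iht (Reassoc.id_comp _).symm).trans
      (Reassoc.tensor_comp _ _ _ _)

theorem graftFirstRight_comp (s : Assoc) {t t' t'' : Assoc} (q : Reassoc t t')
    (q' : Reassoc t' t'') :
    graftFirstRight s (q.comp q') = (graftFirstRight s q).comp (graftFirstRight s q') :=
  Quotient.inductionOn₂ q q' fun _ _ => rfl

/-- The interchange law behind the torus. On tensor products it is functoriality of `⊗`, and on the
generators it is naturality of `α` in its first argument. -/
theorem graftFirst_natural {s s' t t' : Assoc} (p : Reassoc s s') (q : Reassoc t t') :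
    (graftFirstRight s q).comp (graftFirstLeft p t')
      = (graftFirstLeft p t).comp (graftFirstRight s' q) := by
  induction q using Reassoc.ind with
  | h q =>
  induction q with
  | id t => exact (Reassoc.id_comp _).trans (Reassoc.comp_id _).symm
  | @comp t₁ t₂ t₃ q q' ih ih' =>
    let a : Reassoc t₁ t₂ := Quotient.mk (exprSetoid _ _) q
    let b : Reassoc t₂ t₃ := Quotient.mk (exprSetoid _ _) q'
    change (graftFirstRight s (a.comp b)).comp _ = Reassoc.comp _ (graftFirstRight s' (a.comp b))
    rw [graftFirstRight_comp, graftFirstRight_comp, Reassoc.comp_assoc, ih', ← Reassoc.comp_assoc,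
      ih, Reassoc.comp_assoc]
  | inv q ih => exact Reassoc.inv_comp_eq ih
  | @tensor f f' g g' q q' ih ih' =>
    let a : Reassoc f f' := Quotient.mk (exprSetoid _ _) q
    let b : Reassoc g g' := Quotient.mk (exprSetoid _ _) q'
    refine ((Reassoc.tensor_comp (graftFirstRight s a) (graftFirstLeft p f') b
      (Reassoc.id g')).symm.trans ?_).trans
      (Reassoc.tensor_comp (graftFirstLeft p f) (graftFirstRight s' a) (Reassoc.id g) b)
    rw [Reassoc.comp_id, Reassoc.id_comp, ih]
  | assoc f g h =>
    refine (Reassoc.natural (graftFirstLeft p f) (Reassoc.id g) (Reassoc.id h)).trans ?_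
    rw [Reassoc.tensor_id]
    rfl

theorem InT.graftFirstLeft {s s' : Assoc} {p : Reassoc s s'} (hp : InT p) (t : Assoc) :
    InT (graftFirstLeft p t) := by
  induction t with
  | of => exact hp
  | mul t u iht ihu => exact iht.tensor (InT.id u)

theorem InT.graftFirstRight (s : Assoc) {t t' : Assoc} {q : Reassoc t t'} (hq : InT q) :
    InT (graftFirstRight s q) := by
  induction hq with
  | id f => exact InT.id _
  | comp _ _ ih ih' => rw [graftFirstRight_comp]; exact ih.comp ih'
  | @inv _ _ p _ ih =>
    have h : CatalanGroupoid.graftFirstRight s p.inv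
        = (CatalanGroupoid.graftFirstRight s p).inv := Quotient.inductionOn p fun _ => rfl
    exact h ▸ ih.inv
  | @tensor _ _ _ _ p q _ hq ih _ =>
    have h : CatalanGroupoid.graftFirstRight s (p.tensor q)
        = (CatalanGroupoid.graftFirstRight s p).tensor q :=
      Quotient.inductionOn₂ p q fun _ _ => rfl
    exact h ▸ ih.tensor hq
  | assoc f h => exact InT.assoc _ _

/-- All letters of `t` but the replaced one lie to the right of `p`; they are tensored on in blocks
whose exponents of `ρ` add up. -/
theorem IsEdge.graftFirstLeft {i j k : ℕ} {X : FreeMonoid Side} {s s' : Assoc} {p : Reassoc s s'}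
    (hp : IsEdge i j k X p) (t : Assoc) :
    IsEdge i j k (rho ^ (t.length - 1) * X) (graftFirstLeft p t) := by
  induction t with
  | of => exact hp
  | mul t u iht ihu =>
    have h := IsEdge.right u iht
    have := t.length_pos
    rwa [← mul_assoc, ← pow_add, show u.length + (t.length - 1) = (t * u).length - 1 by
      rw [length_mul]; omega] at h

/-- The functor `A a × A b ⥤ A n`, for `n + 1 = a + b`, that substitutes for the first letter. -/
def graftFirstFunctor {a b n : ℕ} (hn : n + 1 = a + b) : A a × A b ⥤ A n where
  obj x := ⟨graftFirst x.1.1 x.2.1, by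
    have := length_graftFirst x.1.1 x.2.1
    rw [x.1.2, x.2.2] at this
    omega⟩
  map {x y} p := A.homMk ((graftFirstLeft (A.reassoc p.1) x.2.1).comp
    (graftFirstRight y.1.1 (A.reassoc p.2)))
  map_id x := by
    refine Eq.trans ?_ (Reassoc.id_comp _)
    exact congrArg (fun p => Reassoc.comp p _) (graftFirstLeft_id _ _)
  map_comp {x y z} p q := by
    change (graftFirstLeft ((A.reassoc p.1).comp (A.reassoc q.1)) x.2.1).comp
        (graftFirstRight z.1.1 ((A.reassoc p.2).comp (A.reassoc q.2)))
      = ((graftFirstLeft (A.reassoc p.1) x.2.1).comp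
          (graftFirstRight y.1.1 (A.reassoc p.2))).comp
        ((graftFirstLeft (A.reassoc q.1) y.2.1).comp (graftFirstRight z.1.1 (A.reassoc q.2)))
    -- Interchanging the two middle factors sorts the composite.
    rw [graftFirstLeft_comp, graftFirstRight_comp, Reassoc.comp_assoc, Reassoc.comp_assoc,
      ← Reassoc.comp_assoc (graftFirstRight _ _), graftFirst_natural, Reassoc.comp_assoc]

theorem cls_graftFirstFunctor_map {a b n : ℕ} (hn : n + 1 = a + b) {x y : A a × A b} (p : x ⟶ y) :
    cls ((graftFirstFunctor hn).map p)
      = cls (f := (graftFirstFunctor hn).obj x) (g := (graftFirstFunctor hn).obj (y.1, x.2))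
          (A.homMk (graftFirstLeft (A.reassoc p.1) x.2.1))
        * cls (f := (graftFirstFunctor hn).obj (y.1, x.2)) (g := (graftFirstFunctor hn).obj y)
          (A.homMk (graftFirstRight y.1.1 (A.reassoc p.2))) :=
  cls_comp (f := (graftFirstFunctor hn).obj x) (g := (graftFirstFunctor hn).obj (y.1, x.2))
    (h := (graftFirstFunctor hn).obj y) _ _

theorem length_pow_of {α : Type*} (a : α) (n : ℕ) : (FreeMonoid.of a ^ n).length = n := by
  induction n with
  | zero => rfl
  | succ n ih => rw [pow_succ, FreeMonoid.length_mul, ih, FreeMonoid.length_of]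

/-- An edge with empty prefix is one of the isomorphisms `f ⊗ (g ⊗ h) → (f ⊗ g) ⊗ h`. -/
theorem IsEdge.exists_eq_assoc {i j k : ℕ} {X : FreeMonoid Side} {f g : Assoc} {p : Reassoc f g}
    (hp : IsEdge i j k X p) (hX : X = 1) :
    ∃ a b c : Assoc, a.length = i ∧ b.length = j ∧ c.length = k ∧
      (⟨f, g, p⟩ : Arrow) = ⟨_, _, Reassoc.assoc a b c⟩ := by
  cases hp with
  | base a b c ha hb hc => exact ⟨a, b, c, ha, hb, hc, rfl⟩
  | left t hp =>
    -- A tensored edge has a nonempty prefix, since `t` has at least one letter.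
    have h := congrArg FreeMonoid.length hX
    rw [FreeMonoid.length_mul, lam, length_pow_of, FreeMonoid.length_one] at h
    have := t.length_pos
    omega
  | right t hp =>
    have h := congrArg FreeMonoid.length hX
    rw [FreeMonoid.length_mul, rho, length_pow_of, FreeMonoid.length_one] at h
    have := t.length_pos
    omega

/-- The first letter lies in the first of the three words, so only `i` grows; for `s` of four
letters, `<1,2,1>` becomes `<4,2,1>`. -/
theorem IsEdge.graftFirstRight {i j k : ℕ} (s : Assoc) {t t' : Assoc} {q : Reassoc t t'}
    (hq : IsEdge i j k 1 q) :
    IsEdge (s.length + i - 1) j k 1 (graftFirstRight s q) := by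
  obtain ⟨a, b, c, ha, hb, hc, h⟩ := hq.exists_eq_assoc rfl
  cases h
  refine IsEdge.base (graftFirst s a) b c ?_ hb hc
  have := length_graftFirst s a
  omega

theorem isTorus_graftFirst {a b : Pi 7} (ha : genClass 7 (rho ^ 3) 1 2 1 = {a})
    (hb : genClass 7 1 4 2 1 = {b}) : IsTorus graftFirst a b := by
  refine ⟨graftFirstFunctor (by norm_num), ?_, fun s t => rfl, fun x y p => ?_⟩
  · rintro ⟨s, t⟩ ⟨s', t'⟩ h
    obtain ⟨h1, h2⟩ := graftFirst_injective (s.2.trans s'.2.symm) (congrArg Subtype.val h)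
    exact Prod.ext (Subtype.ext h1) (Subtype.ext h2)
  rw [cls_graftFirstFunctor_map]
  refine ⟨fun hp hq => ?_, fun hp hq => ?_, fun hp hq => ?_⟩
  · refine Eq.trans (congrArg₂ (· * ·) (?_ : _ = (1 : Pi 7)) (?_ : _ = (1 : Pi 7))) (mul_one 1)
    · exact cls_eq_one _ (hp.graftFirstLeft _)
    · exact cls_eq_one _ (hq.graftFirstRight _)
  · refine Eq.trans (congrArg₂ (· * ·) (?_ : _ = a) (?_ : _ = (1 : Pi 7))) (mul_one a)
    · refine ha.subset ⟨_, _, _, ?_, rfl⟩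
      have h := hp.graftFirstLeft x.2.1
      rwa [x.2.2, mul_one] at h
    · exact cls_eq_one _ (hq.graftFirstRight _)
  · refine Eq.trans (congrArg₂ (· * ·) (?_ : _ = (1 : Pi 7)) (?_ : _ = b)) (one_mul b)
    · exact cls_eq_one _ (hp.graftFirstLeft _)
    · refine hb.subset ⟨_, _, _, ?_, rfl⟩
      have h := hq.graftFirstRight y.1.1
      rwa [y.1.2] at h

/-! ### Substitution for the last letter -/

theorem length_graftLast (s t : Assoc) :
    (graftLast s t).length + 1 = s.length + t.length := by
  induction t with
  | of => rfl
  | mul t u iht ihu =>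
    simp only [graftLast, length_mul, FreeMagma.mul_eq] at iht ⊢
    omega

theorem graftLast_injective {s s' : Assoc} (hs : s.length = s'.length) {t t' : Assoc}
    (h : graftLast s t = graftLast s' t') : s = s' ∧ t = t' := by
  induction t generalizing t' with
  | of =>
    cases t' with
    | of => exact ⟨h, rfl⟩
    | mul t' u' =>
      have h1 := length_graftLast s' (FreeMagma.mul t' u')
      rw [← h] at h1
      have h2 := t'.length_pos
      have h3 := u'.length_pos
      simp only [graftLast, FreeMagma.length] at h1
      omega
  | mul t u iht ihu =>
    cases t' with
    | of =>
      have h1 := length_graftLast s (FreeMagma.mul t u)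
      rw [h] at h1
      have h2 := t.length_pos
      have h3 := u.length_pos
      simp only [graftLast, FreeMagma.length] at h1
      omega
    | mul t' u' =>
      injection h with h1 h2
      obtain ⟨h3, h4⟩ := ihu h2
      exact ⟨h3, congrArg₂ _ h1 h4⟩

/-- Substitute a reassociation for the last letter of an association. -/
def graftLastLeft {s s' : Assoc} (p : Reassoc s s') : ∀ t : Assoc,
    Reassoc (graftLast s t) (graftLast s' t)
  | FreeMagma.of _ => p
  | FreeMagma.mul t u => (Reassoc.id t).tensor (graftLastLeft p u)

/-- Substitute an association for the last letter of a formal reassociation. -/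
def Expr.graftLast (s : Assoc) : ∀ {t t' : Assoc}, Expr t t' →
    Expr (CatalanGroupoid.graftLast s t) (CatalanGroupoid.graftLast s t')
  | _, _, .id t => .id _
  | _, _, .comp p q => (p.graftLast s).comp (q.graftLast s)
  | _, _, .inv p => (p.graftLast s).inv
  | _, _, .tensor p q => p.tensor (q.graftLast s)
  | _, _, .assoc f g h => .assoc f g (CatalanGroupoid.graftLast s h)

theorem Rel.graftLast (s : Assoc) {t t' : Assoc} {p q : Expr t t'} (h : Rel p q) :
    Rel (p.graftLast s) (q.graftLast s) := by
  induction h with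
  | refl p => exact .refl _
  | symm _ ih => exact .symm ih
  | trans _ _ ih ih' => exact .trans ih ih'
  | comp_congr _ _ ih ih' => exact .comp_congr ih ih'
  | inv_congr _ ih => exact .inv_congr ih
  | tensor_congr hp _ _ ih => exact .tensor_congr hp ih
  | id_comp p => exact .id_comp _
  | comp_id p => exact .comp_id _
  | comp_assoc p q r => exact .comp_assoc _ _ _
  | inv_comp p => exact .inv_comp _
  | comp_inv p => exact .comp_inv _
  | tensor_id f g => exact .tensor_id _ _
  | tensor_comp p p' q q' => exact .tensor_comp _ _ _ _
  | natural p q r => exact .natural _ _ _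

/-- Substitute an association for the last letter of a reassociation. -/
def graftLastRight (s : Assoc) {t t' : Assoc} (q : Reassoc t t') :
    Reassoc (graftLast s t) (graftLast s t') :=
  Quotient.map (sa := exprSetoid t t') (sb := exprSetoid _ _)
    (Expr.graftLast s) (fun _ _ h => Rel.graftLast s h) q

theorem graftLastLeft_id (s t : Assoc) :
    graftLastLeft (Reassoc.id s) t = Reassoc.id (graftLast s t) := by
  induction t with
  | of => rfl
  | mul t u iht ihu =>
    exact (congrArg (fun p => Reassoc.tensor (Reassoc.id t) p) ihu).trans (Reassoc.tensor_id _ _)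

theorem graftLastLeft_comp {s s' s'' : Assoc} (p : Reassoc s s') (p' : Reassoc s' s'')
    (t : Assoc) :
    graftLastLeft (p.comp p') t = (graftLastLeft p t).comp (graftLastLeft p' t) := by
  induction t with
  | of => rfl
  | mul t u iht ihu =>
    refine (congrArg₂ Reassoc.tensor (Reassoc.id_comp _).symm ihu).trans
      (Reassoc.tensor_comp _ _ _ _)

theorem graftLastRight_comp (s : Assoc) {t t' t'' : Assoc} (q : Reassoc t t')
    (q' : Reassoc t' t'') :
    graftLastRight s (q.comp q') = (graftLastRight s q).comp (graftLastRight s q') :=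
  Quotient.inductionOn₂ q q' fun _ _ => rfl

/-- As for the first letter, but the generators now use naturality of `α` in its third argument. -/
theorem graftLast_natural {s s' t t' : Assoc} (p : Reassoc s s') (q : Reassoc t t') :
    (graftLastRight s q).comp (graftLastLeft p t')
      = (graftLastLeft p t).comp (graftLastRight s' q) := by
  induction q using Reassoc.ind with
  | h q =>
  induction q with
  | id t => exact (Reassoc.id_comp _).trans (Reassoc.comp_id _).symm
  | @comp t₁ t₂ t₃ q q' ih ih' =>
    let a : Reassoc t₁ t₂ := Quotient.mk (exprSetoid _ _) q
    let b : Reassoc t₂ t₃ := Quotient.mk (exprSetoid _ _) q'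
    change (graftLastRight s (a.comp b)).comp _ = Reassoc.comp _ (graftLastRight s' (a.comp b))
    rw [graftLastRight_comp, graftLastRight_comp, Reassoc.comp_assoc, ih', ← Reassoc.comp_assoc,
      ih, Reassoc.comp_assoc]
  | inv q ih => exact Reassoc.inv_comp_eq ih
  | @tensor f f' g g' q q' ih ih' =>
    let a : Reassoc f f' := Quotient.mk (exprSetoid _ _) q
    let b : Reassoc g g' := Quotient.mk (exprSetoid _ _) q'
    refine ((Reassoc.tensor_comp a (Reassoc.id f') (graftLastRight s b)
      (graftLastLeft p g')).symm.trans ?_).trans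
      (Reassoc.tensor_comp (Reassoc.id f) a (graftLastLeft p g) (graftLastRight s' b))
    rw [Reassoc.comp_id, Reassoc.id_comp, ih']
  | assoc f g h =>
    refine Eq.trans ?_ (Reassoc.natural (Reassoc.id f) (Reassoc.id g) (graftLastLeft p h))
    rw [Reassoc.tensor_id]
    rfl

theorem InT.graftLastLeft {s s' : Assoc} {p : Reassoc s s'} (hp : InT p) (t : Assoc) :
    InT (graftLastLeft p t) := by
  induction t with
  | of => exact hp
  | mul t u iht ihu => exact (InT.id t).tensor ihu

theorem InT.graftLastRight (s : Assoc) {t t' : Assoc} {q : Reassoc t t'} (hq : InT q) :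
    InT (graftLastRight s q) := by
  induction hq with
  | id f => exact InT.id _
  | comp _ _ ih ih' => rw [graftLastRight_comp]; exact ih.comp ih'
  | @inv _ _ p _ ih =>
    have h : CatalanGroupoid.graftLastRight s p.inv
        = (CatalanGroupoid.graftLastRight s p).inv := Quotient.inductionOn p fun _ => rfl
    exact h ▸ ih.inv
  | @tensor _ _ _ _ p q hp _ _ ih =>
    have h : CatalanGroupoid.graftLastRight s (p.tensor q)
        = p.tensor (CatalanGroupoid.graftLastRight s q) :=
      Quotient.inductionOn₂ p q fun _ _ => rfl
    exact h ▸ hp.tensor ih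
  | assoc f h => exact InT.assoc _ _

theorem IsEdge.graftLastLeft {i j k : ℕ} {X : FreeMonoid Side} {s s' : Assoc} {p : Reassoc s s'}
    (hp : IsEdge i j k X p) (t : Assoc) :
    IsEdge i j k (lam ^ (t.length - 1) * X) (graftLastLeft p t) := by
  induction t with
  | of => exact hp
  | mul t u iht ihu =>
    have h := IsEdge.left t ihu
    have := u.length_pos
    rwa [← mul_assoc, ← pow_add, show t.length + (u.length - 1) = (t * u).length - 1 by
      rw [length_mul]; omega] at h

/-- The functor `A a × A b ⥤ A n`, for `n + 1 = a + b`, that substitutes for the last letter. -/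
def graftLastFunctor {a b n : ℕ} (hn : n + 1 = a + b) : A a × A b ⥤ A n where
  obj x := ⟨graftLast x.1.1 x.2.1, by
    have := length_graftLast x.1.1 x.2.1
    rw [x.1.2, x.2.2] at this
    omega⟩
  map {x y} p := A.homMk ((graftLastLeft (A.reassoc p.1) x.2.1).comp
    (graftLastRight y.1.1 (A.reassoc p.2)))
  map_id x := by
    refine Eq.trans ?_ (Reassoc.id_comp _)
    exact congrArg (fun p => Reassoc.comp p _) (graftLastLeft_id _ _)
  map_comp {x y z} p q := by
    change (graftLastLeft ((A.reassoc p.1).comp (A.reassoc q.1)) x.2.1).comp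
        (graftLastRight z.1.1 ((A.reassoc p.2).comp (A.reassoc q.2)))
      = ((graftLastLeft (A.reassoc p.1) x.2.1).comp
          (graftLastRight y.1.1 (A.reassoc p.2))).comp
        ((graftLastLeft (A.reassoc q.1) y.2.1).comp (graftLastRight z.1.1 (A.reassoc q.2)))
    rw [graftLastLeft_comp, graftLastRight_comp, Reassoc.comp_assoc, Reassoc.comp_assoc,
      ← Reassoc.comp_assoc (graftLastRight _ _), graftLast_natural, Reassoc.comp_assoc]

theorem cls_graftLastFunctor_map {a b n : ℕ} (hn : n + 1 = a + b) {x y : A a × A b} (p : x ⟶ y) :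
    cls ((graftLastFunctor hn).map p)
      = cls (f := (graftLastFunctor hn).obj x) (g := (graftLastFunctor hn).obj (y.1, x.2))
          (A.homMk (graftLastLeft (A.reassoc p.1) x.2.1))
        * cls (f := (graftLastFunctor hn).obj (y.1, x.2)) (g := (graftLastFunctor hn).obj y)
          (A.homMk (graftLastRight y.1.1 (A.reassoc p.2))) :=
  cls_comp (f := (graftLastFunctor hn).obj x) (g := (graftLastFunctor hn).obj (y.1, x.2))
    (h := (graftLastFunctor hn).obj y) _ _

theorem IsEdge.graftLastRight {i j k : ℕ} (s : Assoc) {t t' : Assoc} {q : Reassoc t t'}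
    (hq : IsEdge i j k 1 q) :
    IsEdge i j (s.length + k - 1) 1 (graftLastRight s q) := by
  obtain ⟨a, b, c, ha, hb, hc, h⟩ := hq.exists_eq_assoc rfl
  cases h
  refine IsEdge.base a b (graftLast s c) ha hb ?_
  have := length_graftLast s c
  omega

theorem isTorus_graftLast {a b : Pi 7} (ha : genClass 7 (lam ^ 3) 1 2 1 = {a})
    (hb : genClass 7 1 1 2 4 = {b}) : IsTorus graftLast a b := by
  refine ⟨graftLastFunctor (by norm_num), ?_, fun s t => rfl, fun x y p => ?_⟩
  · rintro ⟨s, t⟩ ⟨s', t'⟩ h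
    obtain ⟨h1, h2⟩ := graftLast_injective (s.2.trans s'.2.symm) (congrArg Subtype.val h)
    exact Prod.ext (Subtype.ext h1) (Subtype.ext h2)
  rw [cls_graftLastFunctor_map]
  refine ⟨fun hp hq => ?_, fun hp hq => ?_, fun hp hq => ?_⟩
  · refine Eq.trans (congrArg₂ (· * ·) (?_ : _ = (1 : Pi 7)) (?_ : _ = (1 : Pi 7))) (mul_one 1)
    · exact cls_eq_one _ (hp.graftLastLeft _)
    · exact cls_eq_one _ (hq.graftLastRight _)
  · refine Eq.trans (congrArg₂ (· * ·) (?_ : _ = a) (?_ : _ = (1 : Pi 7))) (mul_one a)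
    · refine ha.subset ⟨_, _, _, ?_, rfl⟩
      have h := hp.graftLastLeft x.2.1
      rwa [x.2.2, mul_one] at h
    · exact cls_eq_one _ (hq.graftLastRight _)
  · refine Eq.trans (congrArg₂ (· * ·) (?_ : _ = (1 : Pi 7)) (?_ : _ = b)) (one_mul b)
    · exact cls_eq_one _ (hp.graftLastLeft _)
    · refine hb.subset ⟨_, _, _, ?_, rfl⟩
      have h := hq.graftLastRight y.1.1
      rwa [y.1.2] at h

/-! ### Integer weights -/

/-- The weight of a formal reassociation, where `F i j k` is the weight of the isomorphisms
`f ⊗ (g ⊗ h) → (f ⊗ g) ⊗ h` with `f`, `g`, `h` of lengths `i`, `j`, `k`. -/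
def Expr.weight (F : ℕ → ℕ → ℕ → ℤ) : ∀ {f g : Assoc}, Expr f g → ℤ
  | _, _, .id _ => 0
  | _, _, .comp p q => p.weight F + q.weight F
  | _, _, .inv p => -p.weight F
  | _, _, .tensor p q => p.weight F + q.weight F
  | _, _, .assoc f g h => F f.length g.length h.length

/-- Reassociations preserve length, so the two instances of `α` in a naturality square have equal
weight; functoriality of `⊗` holds because `ℤ` is commutative. A pentagon relation would constrain
`F`. -/
theorem Rel.weight_eq (F : ℕ → ℕ → ℕ → ℤ) {f g : Assoc} {p q : Expr f g} (h : Rel p q) :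
    p.weight F = q.weight F := by
  induction h with
  | refl p => rfl
  | symm _ ih => exact ih.symm
  | trans _ _ ih ih' => exact ih.trans ih'
  | comp_congr _ _ ih ih' => simp only [Expr.weight, ih, ih']
  | inv_congr _ ih => simp only [Expr.weight, ih]
  | tensor_congr _ _ ih ih' => simp only [Expr.weight, ih, ih']
  | id_comp p => simp only [Expr.weight, zero_add]
  | comp_id p => simp only [Expr.weight, add_zero]
  | comp_assoc p q r => simp only [Expr.weight, add_assoc]
  | inv_comp p => simp only [Expr.weight, neg_add_cancel]
  | comp_inv p => simp only [Expr.weight, add_neg_cancel]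
  | tensor_id f g => simp only [Expr.weight, add_zero]
  | tensor_comp p p' q q' =>
    simp only [Expr.weight]
    ring
  | natural p q r =>
    simp only [Expr.weight, p.length_eq, q.length_eq, r.length_eq]
    ring

/-- The weight of a reassociation. -/
def Reassoc.weight (F : ℕ → ℕ → ℕ → ℤ) {f g : Assoc} (p : Reassoc f g) : ℤ :=
  Quotient.lift (s := exprSetoid f g) (Expr.weight F) (fun _ _ h => Rel.weight_eq F h) p

theorem Reassoc.weight_tensor (F : ℕ → ℕ → ℕ → ℤ) {f f' g g' : Assoc} (p : Reassoc f f')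
    (q : Reassoc g g') : (p.tensor q).weight F = p.weight F + q.weight F :=
  Quotient.inductionOn₂ p q fun _ _ => rfl

theorem Reassoc.weight_comp (F : ℕ → ℕ → ℕ → ℤ) {f g h : Assoc} (p : Reassoc f g)
    (q : Reassoc g h) : (p.comp q).weight F = p.weight F + q.weight F :=
  Quotient.inductionOn₂ p q fun _ _ => rfl

theorem Reassoc.weight_id (F : ℕ → ℕ → ℕ → ℤ) (f : Assoc) : (Reassoc.id f).weight F = 0 := rfl

theorem InT.weight_eq_zero {F : ℕ → ℕ → ℕ → ℤ} (hF : ∀ i k, F i 1 k = 0)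
    {f g : Assoc} {p : Reassoc f g} (hp : InT p) : p.weight F = 0 := by
  induction hp with
  | id f => rfl
  | comp _ _ ih ih' => rw [Reassoc.weight_comp, ih, ih', add_zero]
  | @inv _ _ p _ ih =>
    have h : p.inv.weight F = -p.weight F := Quotient.inductionOn p fun _ => rfl
    rw [h, ih, neg_zero]
  | tensor _ _ ih ih' => rw [Reassoc.weight_tensor, ih, ih', add_zero]
  | assoc f h => exact hF _ _

theorem IsEdge.weight_eq (F : ℕ → ℕ → ℕ → ℤ) {i j k : ℕ} {X : FreeMonoid Side}
    {f g : Assoc} {p : Reassoc f g} (hp : IsEdge i j k X p) : p.weight F = F i j k := by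
  induction hp with
  | base f g h hf hg hh => subst hf hg hh; rfl
  | left t hp ih => rw [Reassoc.weight_tensor, ih, Reassoc.weight_id, zero_add]
  | right t hp ih => rw [Reassoc.weight_tensor, ih, Reassoc.weight_id, add_zero]

theorem exists_weightHom (n : ℕ) {F : ℕ → ℕ → ℕ → ℤ} (hF : ∀ i k, F i 1 k = 0) :
    ∃ φ : Pi n →* Multiplicative ℤ, ∀ {X : FreeMonoid Side} {i j k : ℕ} {a : Pi n},
      a ∈ genClass n X i j k → φ a = Multiplicative.ofAdd (F i j k) := by
  obtain ⟨φ, hφ⟩ := exists_piHom (n := n)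
    (fun p => Multiplicative.ofAdd ((A.reassoc p).weight F))
    (fun p q => congrArg Multiplicative.ofAdd
      (Reassoc.weight_comp F (A.reassoc p) (A.reassoc q)))
    (fun _ hp => congrArg Multiplicative.ofAdd (hp.weight_eq_zero hF))
  refine ⟨φ, ?_⟩
  rintro X i j k a ⟨f, g, p, hp, rfl⟩
  rw [hφ, hp.weight_eq F]

/-! ### Groups with a free abelian subgroup of rank two -/

theorem zpow_mul_zpow_eq_one_of_homs {G : Type*} [Group G] {a b : G}
    (φ ψ : G →* Multiplicative ℤ) (ha : φ a = Multiplicative.ofAdd 1)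
    (hb : φ b = Multiplicative.ofAdd 0) (ha' : ψ a = Multiplicative.ofAdd 0)
    (hb' : ψ b = Multiplicative.ofAdd 1) (m n : ℤ) (h : a ^ m * b ^ n = 1) : m = 0 ∧ n = 0 := by
  have h1 := congrArg (fun x => (φ x).toAdd) h
  have h2 := congrArg (fun x => (ψ x).toAdd) h
  simp only [map_mul, map_zpow, ha, hb, ha', hb', map_one, toAdd_mul, toAdd_zpow, toAdd_ofAdd,
    toAdd_one] at h1 h2
  constructor
  · simpa using h1
  · simpa using h2

/-- Two distinct generators could be sent to two transpositions of three points that do not commute.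
-/
theorem subsingleton_of_freeGroup_comm {α : Type*} (h : ∀ x y : FreeGroup α, x * y = y * x) :
    Subsingleton α := by
  classical
  refine ⟨fun i j => ?_⟩
  by_contra hij
  have h := congrArg (FreeGroup.lift (fun k => if k = i then Equiv.swap (0 : Fin 3) 1
    else Equiv.swap (1 : Fin 3) 2)) (h (FreeGroup.of i) (FreeGroup.of j))
  rw [map_mul, map_mul, FreeGroup.lift_apply_of, FreeGroup.lift_apply_of, if_pos rfl,
    if_neg (Ne.symm hij)] at h
  revert h
  decide

/-- The subgroup generated by `a` and `b` would be both abelian and free, hence cyclic, which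
contradicts their independence. -/
theorem not_isFreeGroup_of_commute {G : Type*} [Group G] {a b : G} (hab : a * b = b * a)
    (h : ∀ m n : ℤ, a ^ m * b ^ n = 1 → m = 0 ∧ n = 0) : ¬ IsFreeGroup G := by
  intro hG
  let H := Subgroup.closure {a, b}
  have hH : ∀ x y : H, x * y = y * x := by
    have : IsMulCommutative H := Subgroup.isMulCommutative_closure (by
      rintro x (rfl | rfl) y (rfl | rfl)
      · rfl
      · exact hab
      · exact hab.symm
      · rfl)
    exact mul_comm'
  -- Nielsen–Schreier: subgroups of free groups are free.
  have : IsFreeGroup H := inferInstance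
  let e := IsFreeGroup.toFreeGroup H
  have hs : Subsingleton (IsFreeGroup.Generators H) :=
    subsingleton_of_freeGroup_comm fun x y => e.symm.injective (by rw [map_mul, map_mul, hH])
  have hc : IsCyclic H := by
    suffices IsCyclic (FreeGroup (IsFreeGroup.Generators H)) from
      isCyclic_of_surjective e.symm e.symm.surjective
    rcases isEmpty_or_nonempty (IsFreeGroup.Generators H) with hempty | ⟨⟨x⟩⟩
    · infer_instance
    · have := uniqueOfSubsingleton x
      infer_instance
  obtain ⟨c, hc⟩ := hc
  obtain ⟨m, hm⟩ := hc ⟨a, Subgroup.subset_closure (by simp)⟩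
  obtain ⟨n, hn⟩ := hc ⟨b, Subgroup.subset_closure (by simp)⟩
  have hm' : (c : G) ^ m = a := congrArg Subtype.val hm
  have hn' : (c : G) ^ n = b := congrArg Subtype.val hn
  -- With `a = c ^ m` and `b = c ^ n`, the relation `a ^ n * b ^ (-m) = 1` forces `m = 0`; then `a =
  -- 1`, which is itself a forbidden relation.
  have h1 := h n (-m) (by rw [← hm', ← hn', ← zpow_mul, ← zpow_mul, ← zpow_add]; ring_nf; simp)
  have h2 := h 1 0 (by rw [← hm', show m = 0 by omega]; simp)
  omega

/-! ### Relations between edges -/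

/-- The indicator functions of the two triples, taken as weights, are dual to `a` and `b`. They
vanish on `T` because neither middle length is `1`. -/
theorem zpow_mul_zpow_eq_one_of_mem_genClass {n i j k i' j' k' : ℕ} {X X' : FreeMonoid Side}
    {a b : Pi n} (hj : j ≠ 1) (hj' : j' ≠ 1) (hne : (i, j, k) ≠ (i', j', k'))
    (ha : a ∈ genClass n X i j k) (hb : b ∈ genClass n X' i' j' k') (m l : ℤ)
    (h : a ^ m * b ^ l = 1) : m = 0 ∧ l = 0 := by
  obtain ⟨φ, hφ⟩ := exists_weightHom n (F := fun u v w => if (u, v, w) = (i, j, k) then 1 else 0)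
    fun u w => if_neg fun h => hj (by simp_all)
  obtain ⟨ψ, hψ⟩ := exists_weightHom n
    (F := fun u v w => if (u, v, w) = (i', j', k') then 1 else 0)
    fun u w => if_neg fun h => hj' (by simp_all)
  refine zpow_mul_zpow_eq_one_of_homs φ ψ ?_ ?_ ?_ ?_ m l h
  · rw [hφ ha, if_pos rfl]
  · rw [hφ hb, if_neg hne.symm]
  · rw [hψ ha, if_neg hne]
  · rw [hψ hb, if_pos rfl]

/-- The naturality square of `α` at `p`, `Id_{xx}` and `Id_x`. In `β` the three letters to the right
of `p` form one block, in `β'` a block of two and then one of one, so both have prefix `ρ^3`. -/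
theorem exists_genClass_rho : ∃ a b : Pi 7, genClass 7 1 4 2 1 = {a} ∧
    genClass 7 (rho ^ 3) 1 2 1 = {b} ∧ a * b = b * a := by
  let x := letter
  let f := x * ((x * x) * x)
  let f' := (x * (x * x)) * x
  let p : Reassoc f f' := Reassoc.assoc x (x * x) x
  have hp : IsEdge 1 2 1 1 p := IsEdge.base _ _ _ rfl rfl rfl
  let o₁ : A 7 := ⟨f * ((x * x) * x), rfl⟩
  let o₂ : A 7 := ⟨(f * (x * x)) * x, rfl⟩
  let o₃ : A 7 := ⟨f' * ((x * x) * x), rfl⟩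
  let o₄ : A 7 := ⟨(f' * (x * x)) * x, rfl⟩
  let α : o₁ ⟶ o₂ := A.homMk (Reassoc.assoc f (x * x) x)
  let α' : o₃ ⟶ o₄ := A.homMk (Reassoc.assoc f' (x * x) x)
  let β : o₁ ⟶ o₃ := A.homMk (p.tensor (Reassoc.id ((x * x) * x)))
  let β' : o₂ ⟶ o₄ := A.homMk ((p.tensor (Reassoc.id (x * x))).tensor (Reassoc.id x))
  have hα : IsEdge 4 2 1 1 (A.reassoc α) := IsEdge.base _ _ _ rfl rfl rfl
  have hα' : IsEdge 4 2 1 1 (A.reassoc α') := IsEdge.base _ _ _ rfl rfl rfl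
  have hβ : IsEdge 1 2 1 (rho ^ 3) (A.reassoc β) := IsEdge.right ((x * x) * x) hp
  have hβ' : IsEdge 1 2 1 (rho ^ 3) (A.reassoc β') := IsEdge.right x (IsEdge.right (x * x) hp)
  have h : α ≫ β' = β ≫ α' := by
    refine (Reassoc.natural p (Reassoc.id (x * x)) (Reassoc.id x)).trans ?_
    rw [Reassoc.tensor_id]
    rfl
  refine ⟨_, _, genClass_eq_singleton hα, genClass_eq_singleton hβ, ?_⟩
  have h' := congrArg cls h
  rwa [cls_comp, cls_comp, (hα'.tequiv hα).cls_eq, (hβ'.tequiv hβ).cls_eq] at h'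

/-- The mirror image: `p` now stands in the third argument of `α`. -/
theorem exists_genClass_lam : ∃ a b : Pi 7, genClass 7 1 1 2 4 = {a} ∧
    genClass 7 (lam ^ 3) 1 2 1 = {b} ∧ a * b = b * a := by
  let x := letter
  let f := x * ((x * x) * x)
  let f' := (x * (x * x)) * x
  let p : Reassoc f f' := Reassoc.assoc x (x * x) x
  have hp : IsEdge 1 2 1 1 p := IsEdge.base _ _ _ rfl rfl rfl
  let o₁ : A 7 := ⟨x * ((x * x) * f), rfl⟩
  let o₂ : A 7 := ⟨(x * (x * x)) * f, rfl⟩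
  let o₃ : A 7 := ⟨x * ((x * x) * f'), rfl⟩
  let o₄ : A 7 := ⟨(x * (x * x)) * f', rfl⟩
  let α : o₁ ⟶ o₂ := A.homMk (Reassoc.assoc x (x * x) f)
  let α' : o₃ ⟶ o₄ := A.homMk (Reassoc.assoc x (x * x) f')
  let β : o₁ ⟶ o₃ := A.homMk ((Reassoc.id x).tensor ((Reassoc.id (x * x)).tensor p))
  let β' : o₂ ⟶ o₄ := A.homMk ((Reassoc.id (x * (x * x))).tensor p)
  have hα : IsEdge 1 2 4 1 (A.reassoc α) := IsEdge.base _ _ _ rfl rfl rfl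
  have hα' : IsEdge 1 2 4 1 (A.reassoc α') := IsEdge.base _ _ _ rfl rfl rfl
  have hβ : IsEdge 1 2 1 (lam ^ 3) (A.reassoc β) := IsEdge.left x (IsEdge.left (x * x) hp)
  have hβ' : IsEdge 1 2 1 (lam ^ 3) (A.reassoc β') := IsEdge.left (x * (x * x)) hp
  have h : α ≫ β' = β ≫ α' := by
    refine Eq.trans ?_ (Reassoc.natural (Reassoc.id x) (Reassoc.id (x * x)) p)
    rw [Reassoc.tensor_id]
    rfl
  refine ⟨_, _, genClass_eq_singleton hα, genClass_eq_singleton hβ, ?_⟩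
  have h' := congrArg cls h
  rwa [cls_comp, cls_comp, (hα'.tequiv hα).cls_eq, (hβ'.tequiv hβ).cls_eq] at h'

end CatalanGroupoid

/-! ### Assembly of the theorem -/

theorem mainTheorem7 :
    (∃ a b c d : Pi 7,
      genClass 7 1 4 2 1 = {a} ∧ genClass 7 (rho ^ 3) 1 2 1 = {b} ∧
      genClass 7 1 1 2 4 = {c} ∧ genClass 7 (lam ^ 3) 1 2 1 = {d} ∧
      a * b = b * a ∧ c * d = d * c ∧
      (∀ m n : ℤ, a ^ m * b ^ n = 1 → m = 0 ∧ n = 0) ∧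
      (∀ m n : ℤ, c ^ m * d ^ n = 1 → m = 0 ∧ n = 0) ∧
      IsTorus graftFirst b a ∧ IsTorus graftLast d c) ∧
    ¬ IsFreeGroup (Pi 7) ∧
    ∀ m : ℕ,
      (∃ φ : Pi 7 →* Pi (m + 7), Function.Injective φ ∧
        ∀ (t : A m) (f g : A 7) (p : f ⟶ g),
          φ (cls p) = cls (A.tensorHom (CategoryTheory.CategoryStruct.id t) p)) ∧
      ¬ IsFreeGroup (Pi (m + 7)) := by
  obtain ⟨a, b, ha, hb, hab⟩ := exists_genClass_rho
  obtain ⟨c, d, hc, hd, hcd⟩ := exists_genClass_lam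
  have hab' : ∀ m n : ℤ, a ^ m * b ^ n = 1 → m = 0 ∧ n = 0 :=
    zpow_mul_zpow_eq_one_of_mem_genClass (by decide) (by decide) (by decide)
      (ha.symm.subset rfl) (hb.symm.subset rfl)
  have hcd' : ∀ m n : ℤ, c ^ m * d ^ n = 1 → m = 0 ∧ n = 0 :=
    zpow_mul_zpow_eq_one_of_mem_genClass (by decide) (by decide) (by decide)
      (hc.symm.subset rfl) (hd.symm.subset rfl)
  refine ⟨⟨a, b, c, d, ha, hb, hc, hd, hab, hcd, hab', hcd', isTorus_graftFirst hb ha,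
    isTorus_graftLast hd hc⟩, not_isFreeGroup_of_commute hab hab', fun m => ?_⟩
  obtain ⟨φ, hφ, hφ'⟩ : ∃ φ : Pi 7 →* Pi (m + 7), Function.Injective φ ∧
      ∀ (t : A m) (f g : A 7) (p : f ⟶ g), φ (cls p) = cls (A.tensorHom (𝟙 t) p) := by
    cases m with
    -- No association has length `0`, so the condition on `t` is vacuous and the identity serves.
    | zero => exact ⟨MonoidHom.id _, Function.injective_id,
        fun t => absurd t.2 (FreeMagma.length_pos t.1).ne'⟩
    | succ m => exact exists_injective_piTensorLeft (by decide) m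
  -- Injectivity carries the independent commuting pair of `Pi 7` into `Pi (m + 7)`.
  refine ⟨⟨φ, hφ, hφ'⟩, not_isFreeGroup_of_commute (a := φ a) (b := φ b) ?_ fun k l h => ?_⟩
  · rw [← map_mul, hab, map_mul]
  · rw [← map_zpow, ← map_zpow, ← map_mul] at h
    exact hab' k l (hφ (h.trans (map_one φ).symm))
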